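/- \textbf{Theorem (Hilbert's Nullstellensatz for skew PBW extensions).} \emph{Setting.} Let $\mathbb F$ be an algebraically closed field and let $A\supseteq\mathbb F$ be a ring (associative with $1$; $\mathbb F$ need not be central in $A$). Let $x_1,\dots,x_n\in A$ be such that $A=\sigma(\mathbb F)\langle x_1,\dots,x_n\rangle$ is a skew PBW extension of $\mathbb F$, that is: $A$ is a free left $\mathbb F$-module with basis the standard monomials $x_1^{\alpha_1}\cdots x_n^{\alpha_n}$, $\alpha\in\mathbb N^n$; for every $i$ and every $r\in\mathbb F\setminus\{0\}$ there is $c_{i,r}\in\mathbb F\setminus\{0\}$ with $x_ir-c_{i,r}x_i\in\mathbb F$; and for all $i,j$ there is $c_{i,j}\in\mathbb F\setminus\{0\}$ with $x_jx_i-c_{i,j}x_ix_j\in\mathbb F+\mathbb Fx_1+\cdots+\mathbb Fx_n$. Assume that $A$ is quasi-commutative (for every $i$ and every $r\neq0$ there is $c_{i,r}\ne0$ with $x_ir=c_{i,r}x_i$, and for all $i,j$ there is $c_{i,j}\neq0$ with $x_jx_i=c_{i,j}x_ix_j$) and bijective (the maps $\sigma_i:\mathbb F\to\mathbb F$ determined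 by $x_ir-\sigma_i(r)x_i\in\mathbb F$ are bijective and the $c_{i,j}$ are invertible). Assume that the center $Z(A)$ is a polynomial ring in $n$ variables with coefficients in $\mathbb F$: there are a ring homomorphism $\kappa:\mathbb F\to Z(A)$ (for instance the inclusion, when $\mathbb F\subseteq Z(A)$) and elements $y_1,\dots,y_n\in Z(A)$ such that the ring homomorphism $\mathbb F[t_1,\dots,t_n]\to Z(A)$ that is $\kappa$ on $\mathbb F$ and sends $t_i\mapsto y_i$ is an isomorphism. \emph{Notation.} For $Z=(z_1,\dots,z_n)\in\mathbb F^n$ let $\langle Z\rangle$ be the two-sided ideal of $A$ generated by $x_1-z_1,\dots,x_n-z_n$, and for $f\in A$ write $f(Z)=0$ if $f\in\langle Z\rangle$. For $S\subseteq A$ put $V(S)=\{Z\in\mathbb F^n\mid f(Z)=0\text{ for all }f\in S\}$, and for $X\subseteq\mathbb F^n$ put $I(X)=\{g\in A\mid g(Z)=0\text{ for all }Z\in X\}$, a two-sided ideal of $A$. Define $V_{Z(A)}$ and $I_{Z(A)}$ in the same way with $Z(A)$, $\kappa$, $y_1,\dots,y_n$ in place of $A$, the inclusion $\mathbb F\subseteq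 A$, $x_1,\dots,x_n$; so the roots of $f\in Z(A)$ are the $Z\in\mathbb F^n$ for which $f$ lies in the ideal of $Z(A)$ generated by $y_1-\kappa(z_1),\dots,y_n-\kappa(z_n)$. A two-sided ideal $P\neq A$ is prime if for all left ideals $L,L'$ of $A$ one has $LL'\subseteq P$ if and only if $L\subseteq P$ or $L'\subseteq P$; $\sqrt I$ denotes the intersection of all prime ideals of $A$ containing $I$ (equal to $A$ if there are none). \emph{Conclusion.} For every two-sided ideal $I$ of $A$, with $J=I\cap Z(A)$, $$\langle I_{Z(A)}(V_{Z(A)}(J))\rangle\subseteq\sqrt I\subseteq I(V(I)),$$ where $\langle\,\cdot\,\rangle$ on the left is the two-sided ideal of $A$ generated by the given subset of $Z(A)\subseteq A$. -/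

import Mathlib

namespace SkewPBW

/-- The standard monomial `x₁^α₁ ⋯ xₙ^αₙ` (factors in this order). -/
def stdMonomial {A : Type*} [Ring A] {n : ℕ} (x : Fin n → A) (α : Fin n → ℕ) : A :=
  (List.ofFn fun i => x i ^ α i).prod

/-- `A` is a skew PBW extension of `R` in the elements `x₁, …, xₙ`; the inclusion of `R` in `A` is
the injective ring homomorphism `ι`, and the left `R`-module structure of `A` is `(r, a) ↦ ι r * a`.
-/
structure IsSkewPBW {R A : Type*} [Ring R] [Ring A] {n : ℕ} (ι : R →+* A) (x : Fin n → A) :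
    Prop where
  injective : Function.Injective ι
  /-- `A` is a free left `R`-module with basis the standard monomials. -/
  basis : ∀ f : A, ∃! c : (Fin n → ℕ) →₀ R, f = c.sum fun α r => ι r * stdMonomial x α
  var_coeff : ∀ (i : Fin n) (r : R), r ≠ 0 →
    ∃ c : R, c ≠ 0 ∧ ∃ d : R, x i * ι r - ι c * x i = ι d
  var_var : ∀ i j : Fin n, ∃ c : R, c ≠ 0 ∧ ∃ (d : R) (a : Fin n → R),
    x j * x i - ι c * x i * x j = ι d + ∑ k, ι (a k) * x k

/-- Quasi-commutativity of a skew PBW extension. -/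
structure IsQuasiCommutative {R A : Type*} [Ring R] [Ring A] {n : ℕ} (ι : R →+* A)
    (x : Fin n → A) : Prop where
  var_coeff : ∀ (i : Fin n) (r : R), r ≠ 0 → ∃ c : R, c ≠ 0 ∧ x i * ι r = ι c * x i
  var_var : ∀ i j : Fin n, ∃ c : R, c ≠ 0 ∧ x j * x i = ι c * x i * x j

/-- Bijectivity of a skew PBW extension: the maps `σᵢ` with `xᵢ r - σᵢ(r) xᵢ ∈ R` (they are
uniquely determined, by freeness over the standard monomials) are bijective, and the coefficients
`cᵢⱼ` with `xⱼ xᵢ - cᵢⱼ xᵢ xⱼ ∈ R + R x₁ + ⋯ + R xₙ` are invertible. -/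
structure IsBijective {R A : Type*} [Ring R] [Ring A] {n : ℕ} (ι : R →+* A)
    (x : Fin n → A) : Prop where
  sigma_bijective : ∀ i : Fin n, ∃ σ : R → R, Function.Bijective σ ∧
    ∀ r : R, ∃ d : R, x i * ι r - ι (σ r) * x i = ι d
  coeff_isUnit : ∀ i j : Fin n, ∃ c : R, IsUnit c ∧ ∃ (d : R) (a : Fin n → R),
    x j * x i - ι c * x i * x j = ι d + ∑ k, ι (a k) * x k

/-- `S` is a polynomial ring in the (commuting) variables `y₁, …, yₙ` with coefficients in `F`,
where `F` maps to `S` by `κ`: the homomorphism `F[t₁, …, tₙ] → S` that is `κ` on `F` and sends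
`tᵢ` to `yᵢ` is an isomorphism. -/
def IsPolynomialRing {F S : Type*} [CommRing F] [CommRing S] {n : ℕ} (κ : F →+* S)
    (y : Fin n → S) : Prop :=
  Function.Bijective (MvPolynomial.eval₂Hom κ y)

/-- The two-sided ideal `⟨Z⟩ = ⟨x₁ - z₁, …, xₙ - zₙ⟩`. -/
def pointIdeal {R A : Type*} [Ring R] [Ring A] {n : ℕ} (ι : R →+* A) (x : Fin n → A)
    (Z : Fin n → R) : TwoSidedIdeal A :=
  TwoSidedIdeal.span (Set.range fun i => x i - ι (Z i))

/-- `Z` is a root of `f`, in symbols `f(Z) = 0`. -/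
def IsRoot {R A : Type*} [Ring R] [Ring A] {n : ℕ} (ι : R →+* A) (x : Fin n → A)
    (f : A) (Z : Fin n → R) : Prop :=
  f ∈ pointIdeal ι x Z

/-- The vanishing set `V(S)`. -/
def vanishingSet {R A : Type*} [Ring R] [Ring A] {n : ℕ} (ι : R →+* A) (x : Fin n → A)
    (S : Set A) : Set (Fin n → R) :=
  {Z | ∀ f ∈ S, IsRoot ι x f Z}

/-- The ideal of points `I(X) = {g ∈ A | g(Z) = 0 for every Z ∈ X}`. -/
def idealOfPoints {R A : Type*} [Ring R] [Ring A] {n : ℕ} (ι : R →+* A) (x : Fin n → A)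
    (X : Set (Fin n → R)) : TwoSidedIdeal A :=
  TwoSidedIdeal.mk' {g | ∀ Z ∈ X, IsRoot ι x g Z}
    (fun Z _ => (pointIdeal ι x Z).zero_mem)
    (fun hf hg Z hZ => (pointIdeal ι x Z).add_mem (hf Z hZ) (hg Z hZ))
    (fun hf Z hZ => (pointIdeal ι x Z).neg_mem (hf Z hZ))
    (fun hf Z hZ => (pointIdeal ι x Z).mul_mem_left _ _ (hf Z hZ))
    (fun hf Z hZ => (pointIdeal ι x Z).mul_mem_right _ _ (hf Z hZ))

/-- A two-sided ideal `P ≠ S` is prime if, for all left ideals `L`, `J` of `S`, `L J ⊆ P` if and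
only if `L ⊆ P` or `J ⊆ P`. -/
structure IsPrimeIdeal {S : Type*} [Ring S] (P : TwoSidedIdeal S) : Prop where
  ne_top : P ≠ ⊤
  mul_le_iff : ∀ L J : Ideal S,
    L * J ≤ TwoSidedIdeal.asIdeal P ↔ L ≤ TwoSidedIdeal.asIdeal P ∨ J ≤ TwoSidedIdeal.asIdeal P

/-- The (prime) radical `√I`: the intersection of all prime ideals containing `I`, which is the
whole ring if there are none. -/
def radical {S : Type*} [Ring S] (I : TwoSidedIdeal S) : TwoSidedIdeal S :=
  sInf {P | IsPrimeIdeal P ∧ I ≤ P}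

end SkewPBW

/-! Left inclusion: on the commutative ring `Z(A)` the classical Nullstellensatz shows that an
element vanishing on `V(J)` has a power in `J ⊆ I`. A prime ideal containing a product with a
central factor contains one of the two factors, so every prime ideal over `I` contains the element
itself.

Right inclusion: modulo `⟨Z⟩` every variable becomes a scalar, so `A / ⟨Z⟩` is a homomorphic image
of the field of scalars, hence zero or a field. Thus `⟨Z⟩` is improper or prime, and in the latter
case it is one of the ideals intersected in `√I` as soon as `Z ∈ V(I)`.
-/

namespace SkewPBW

section PrimeIdeals

variable {A : Type*} [Ring A] {P : TwoSidedIdeal A}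

theorem isPrimeIdeal_of_mem_or_mem (hP : P ≠ ⊤) (h : ∀ a b, a * b ∈ P → a ∈ P ∨ b ∈ P) :
    IsPrimeIdeal P where
  ne_top := hP
  mul_le_iff L J := by
    constructor
    · intro hLJ
      by_contra! ⟨hL, hJ⟩
      obtain ⟨a, haL, haP⟩ := SetLike.not_le_iff_exists.1 hL
      obtain ⟨b, hbJ, hbP⟩ := SetLike.not_le_iff_exists.1 hJ
      exact (h a b (hLJ (Ideal.mul_mem_mul haL hbJ))).elim haP hbP
    · rintro (hL | hJ)
      · exact (Ideal.mul_mono_left hL).trans Ideal.mul_le_left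
      · exact Ideal.mul_le_right.trans hJ

theorem isPrimeIdeal_ker {B : Type*} [Ring B] [Nontrivial B] [NoZeroDivisors B] (f : A →+* B) :
    IsPrimeIdeal (TwoSidedIdeal.ker f) := by
  refine isPrimeIdeal_of_mem_or_mem (fun htop => ?_) fun a b hab => ?_
  · have h_one : f 1 = 0 := (TwoSidedIdeal.mem_ker f).1 (htop ▸ TwoSidedIdeal.mem_top A)
    exact one_ne_zero ((map_one f).symm.trans h_one)
  · simpa only [TwoSidedIdeal.mem_ker, map_mul, mul_eq_zero] using hab

theorem IsPrimeIdeal.mem_or_mem_of_mem_center (hP : IsPrimeIdeal P) {a b : A}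
    (ha : a ∈ Subring.center A) (hab : a * b ∈ P) : a ∈ P ∨ b ∈ P := by
  have h_mul : Ideal.span {a} * Ideal.span {b} ≤ TwoSidedIdeal.asIdeal P := by
    refine Ideal.mul_le.2 fun _ hu _ hv => ?_
    obtain ⟨r, rfl⟩ := Ideal.mem_span_singleton'.1 hu
    obtain ⟨s, rfl⟩ := Ideal.mem_span_singleton'.1 hv
    have h_comm : r * a * (s * b) = r * s * (a * b) :=
      Commute.mul_mul_mul_comm (Subring.mem_center_iff.1 ha s).symm r b
    exact h_comm ▸ P.mul_mem_left _ _ hab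
  exact ((hP.mul_le_iff _ _).1 h_mul).imp
    (fun h => h (Ideal.mem_span_singleton_self a)) fun h => h (Ideal.mem_span_singleton_self b)

theorem IsPrimeIdeal.mem_of_pow_mem (hP : IsPrimeIdeal P) {a : A} (ha : a ∈ Subring.center A)
    {m : ℕ} (h : a ^ m ∈ P) : a ∈ P := by
  induction m with
  | zero => exact absurd (TwoSidedIdeal.eq_top _ (pow_zero a ▸ h)) hP.ne_top
  | succ m ih => exact (hP.mem_or_mem_of_mem_center ha (pow_succ' a m ▸ h)).elim id ih

theorem mem_radical {I : TwoSidedIdeal A} {a : A} :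
    a ∈ radical I ↔ ∀ P, IsPrimeIdeal P → I ≤ P → a ∈ P := by
  simp only [radical, TwoSidedIdeal.mem_sInf, Set.mem_ofPred_eq, and_imp]

end PrimeIdeals

section PointIdeals

variable {R A B : Type*} [Ring R] [Ring A] [Ring B] {n : ℕ} {ι : R →+* A} {x : Fin n → A}
  {Z : Fin n → R}

theorem pointIdeal_le_ker_iff {f : A →+* B} :
    pointIdeal ι x Z ≤ TwoSidedIdeal.ker f ↔ ∀ i, f (x i) = f (ι (Z i)) := by
  simp only [pointIdeal, TwoSidedIdeal.span_le, Set.range_subset_iff, SetLike.mem_coe,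
    TwoSidedIdeal.mem_ker, map_sub, sub_eq_zero]

theorem mk_var_eq_mk_coord (i : Fin n) :
    (pointIdeal ι x Z).ringCon.mk' (x i) = (pointIdeal ι x Z).ringCon.mk' (ι (Z i)) :=
  pointIdeal_le_ker_iff.1 (TwoSidedIdeal.ker_ringCon_mk' _).ge i

theorem mem_idealOfPoints {X : Set (Fin n → R)} {a : A} :
    a ∈ idealOfPoints ι x X ↔ ∀ Z ∈ X, IsRoot ι x a Z :=
  TwoSidedIdeal.mem_mk' _ _ _ _ _ _ _

theorem IsSkewPBW.closure_eq_top (hA : IsSkewPBW ι x) :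
    Subring.closure (Set.range ι ∪ Set.range x) = ⊤ := by
  refine (Subring.eq_top_iff' _).2 fun a => ?_
  obtain ⟨c, rfl, -⟩ := hA.basis a
  refine sum_mem fun α _ => mul_mem (Subring.subset_closure (.inl ⟨_, rfl⟩)) ?_
  refine list_prod_mem fun b hb => ?_
  obtain ⟨i, rfl⟩ := List.mem_ofFn.1 hb
  exact pow_mem (Subring.subset_closure (.inr ⟨i, rfl⟩)) _

theorem surjective_comp_of_closure_eq_top (hx : Subring.closure (Set.range ι ∪ Set.range x) = ⊤)
    {f : A →+* B} (hf : Function.Surjective f) (hfx : ∀ i, f (x i) = f (ι (Z i))) :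
    Function.Surjective (f.comp ι) := by
  have h_gen : Subring.closure (Set.range ι ∪ Set.range x) ≤ (f.comp ι).range.comap f := by
    refine Subring.closure_le.2 (Set.union_subset ?_ ?_)
    · rintro _ ⟨r, rfl⟩
      exact ⟨r, rfl⟩
    · rintro _ ⟨i, rfl⟩
      exact ⟨Z i, (hfx i).symm⟩
  intro b
  obtain ⟨a, rfl⟩ := hf b
  exact h_gen (hx ▸ Subring.mem_top a)

theorem isPrimeIdeal_pointIdeal {D : Type*} [DivisionRing D] {ι : D →+* A} {Z : Fin n → D}
    (hx : Subring.closure (Set.range ι ∪ Set.range x) = ⊤) (hZ : pointIdeal ι x Z ≠ ⊤) :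
    IsPrimeIdeal (pointIdeal ι x Z) := by
  let q := (pointIdeal ι x Z).ringCon.mk'
  have h_surj : Function.Surjective (q.comp ι) :=
    surjective_comp_of_closure_eq_top hx (RingCon.mk'_surjective _) mk_var_eq_mk_coord
  have : Nontrivial (pointIdeal ι x Z).ringCon.Quotient :=
    RingCon.nontrivial_quotient.2 fun h => hZ (TwoSidedIdeal.ringCon_injective h)
  let e := RingEquiv.ofBijective (q.comp ι) ⟨(q.comp ι).injective, h_surj⟩
  have : NoZeroDivisors (pointIdeal ι x Z).ringCon.Quotient :=
    e.symm.toMulEquiv.noZeroDivisors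
  exact TwoSidedIdeal.ker_ringCon_mk' (pointIdeal ι x Z) ▸ isPrimeIdeal_ker q

theorem radical_le_idealOfPoints_vanishingSet {D : Type*} [DivisionRing D] {ι : D →+* A}
    (hx : Subring.closure (Set.range ι ∪ Set.range x) = ⊤) (I : TwoSidedIdeal A) :
    radical I ≤ idealOfPoints ι x (vanishingSet ι x (I : Set A)) := by
  refine fun a ha => mem_idealOfPoints.2 fun Z hIZ => ?_
  by_cases htop : pointIdeal ι x Z = ⊤
  · exact (htop ▸ TwoSidedIdeal.mem_top A : a ∈ pointIdeal ι x Z)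
  · exact mem_radical.1 ha _ (isPrimeIdeal_pointIdeal hx htop) hIZ

end PointIdeals

section Nullstellensatz

open MvPolynomial

variable {F S : Type*} [CommRing S] {n : ℕ} {y : Fin n → S}

theorem isRoot_eval₂Hom_of_eval_eq_zero [CommRing F] {κ : F →+* S} {p : MvPolynomial (Fin n) F}
    {Z : Fin n → F} (hp : eval Z p = 0) : IsRoot κ y (eval₂Hom κ y p) Z := by
  let q := (pointIdeal κ y Z).ringCon.mk'
  have h_comp : q.comp (eval₂Hom κ y) = (q.comp κ).comp (eval Z) :=
    ringHom_ext (fun r => by simp) fun i => by simpa [q] using mk_var_eq_mk_coord (ι := κ) i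
  have h_zero : q (eval₂Hom κ y p) = 0 := by
    simpa only [RingHom.comp_apply, hp, map_zero] using RingHom.congr_fun h_comp p
  rw [IsRoot, ← TwoSidedIdeal.ker_ringCon_mk' (pointIdeal κ y Z)]
  exact (TwoSidedIdeal.mem_ker q).2 h_zero

theorem eval_eq_zero_of_isRoot_eval₂Hom [CommRing F] {κ : F →+* S}
    (hy : Function.Surjective (eval₂Hom κ y)) {Z : Fin n → F}
    (hZ : RingHom.ker (eval₂Hom κ y) ≤ RingHom.ker (eval Z)) {p : MvPolynomial (Fin n) F}
    (hp : IsRoot κ y (eval₂Hom κ y p) Z) : eval Z p = 0 := by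
  let evalS : S →+* F := (eval₂Hom κ y).liftOfSurjective hy ⟨eval Z, hZ⟩
  have h_evalS (q : MvPolynomial (Fin n) F) : evalS (eval₂Hom κ y q) = eval Z q :=
    RingHom.liftOfSurjective_comp_apply _ hy ⟨eval Z, hZ⟩ q
  have h_point : pointIdeal κ y Z ≤ TwoSidedIdeal.ker evalS := by
    refine pointIdeal_le_ker_iff.2 fun i => ?_
    calc evalS (y i) = eval Z (X i) := by simpa using h_evalS (X i)
      _ = eval Z (C (Z i)) := by simp
      _ = evalS (κ (Z i)) := by simpa using (h_evalS (C (Z i))).symm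
  exact (h_evalS p).symm.trans ((TwoSidedIdeal.mem_ker evalS).1 (h_point hp))

variable [Field F] [IsAlgClosed F] {κ : F →+* S}

theorem exists_pow_mem_of_mem_idealOfPoints_vanishingSet
    (hy : Function.Surjective (eval₂Hom κ y)) {J : TwoSidedIdeal S} {f : S}
    (hf : f ∈ idealOfPoints κ y (vanishingSet κ y (J : Set S))) : ∃ m : ℕ, f ^ m ∈ J := by
  obtain ⟨p, rfl⟩ := hy f
  let K : Ideal (MvPolynomial (Fin n) F) := (TwoSidedIdeal.asIdeal J).comap (eval₂Hom κ y)
  have hp : p ∈ vanishingIdeal F (zeroLocus F K) := by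
    intro Z hZK
    have hZ_ker : RingHom.ker (eval₂Hom κ y) ≤ RingHom.ker (eval Z) :=
      fun q hq => hZK q (Ideal.ker_le_comap _ hq)
    have hZ_mem : Z ∈ vanishingSet κ y (J : Set S) := by
      intro g hg
      obtain ⟨q, rfl⟩ := hy g
      exact isRoot_eval₂Hom_of_eval_eq_zero (hZK q hg)
    exact eval_eq_zero_of_isRoot_eval₂Hom hy hZ_ker (mem_idealOfPoints.1 hf Z hZ_mem)
  rw [vanishingIdeal_zeroLocus_eq_radical] at hp
  obtain ⟨m, hm⟩ := hp
  exact ⟨m, map_pow (eval₂Hom κ y) p m ▸ hm⟩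

theorem span_image_idealOfPoints_vanishingSet_le_radical {A : Type*} [Ring A]
    (hy : Function.Surjective (eval₂Hom κ y)) {φ : S →+* A} (hφ : φ.range ≤ Subring.center A)
    (I : TwoSidedIdeal A) :
    TwoSidedIdeal.span (φ '' (idealOfPoints κ y
      (vanishingSet κ y (TwoSidedIdeal.comap φ I : Set S)) : Set S)) ≤ radical I := by
  refine TwoSidedIdeal.span_le.2 ?_
  rintro _ ⟨f, hf, rfl⟩
  obtain ⟨m, hm⟩ := exists_pow_mem_of_mem_idealOfPoints_vanishingSet hy hf
  have h_pow : φ f ^ m ∈ I := map_pow φ f m ▸ (TwoSidedIdeal.mem_comap φ).1 hm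
  exact mem_radical.2 fun P hP hIP => hP.mem_of_pow_mem (hφ ⟨f, rfl⟩) (hIP h_pow)

end Nullstellensatz

end SkewPBW

open SkewPBW in
theorem mainTheorem1_general {D F S A : Type*} [DivisionRing D] [Field F] [IsAlgClosed F]
    [CommRing S] [Ring A] {m n : ℕ} (ι : D →+* A) (x : Fin n → A)
    (hx : Subring.closure (Set.range ι ∪ Set.range x) = ⊤)
    (φ : S →+* A) (hφ : φ.range ≤ Subring.center A) (κ : F →+* S) (y : Fin m → S)
    (hy : Function.Surjective (MvPolynomial.eval₂Hom κ y)) (I : TwoSidedIdeal A) :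
    TwoSidedIdeal.span (φ '' (idealOfPoints κ y
        (vanishingSet κ y (TwoSidedIdeal.comap φ I : Set S)) : Set S)) ≤ radical I ∧
      radical I ≤ idealOfPoints ι x (vanishingSet ι x (I : Set A)) :=
  ⟨span_image_idealOfPoints_vanishingSet_le_radical hy hφ I,
    radical_le_idealOfPoints_vanishingSet hx I⟩

theorem mainTheorem1 {F : Type*} [Field F] [IsAlgClosed F] {A : Type*} [Ring A] {n : ℕ}
    (ι : F →+* A) (x : Fin n → A)
    (hA : SkewPBW.IsSkewPBW ι x)
    (hqc : SkewPBW.IsQuasiCommutative ι x)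
    (hbij : SkewPBW.IsBijective ι x)
    (κ : F →+* Subring.center A) (y : Fin n → Subring.center A)
    (hZ : SkewPBW.IsPolynomialRing κ y)
    (I : TwoSidedIdeal A) (J : TwoSidedIdeal (Subring.center A))
    (hJ : J = TwoSidedIdeal.comap (Subring.center A).subtype I) :
    TwoSidedIdeal.span ((Subring.center A).subtype ''
        (SkewPBW.idealOfPoints κ y (SkewPBW.vanishingSet κ y (J : Set (Subring.center A))) :
          Set (Subring.center A))) ≤ SkewPBW.radical I ∧
      SkewPBW.radical I ≤ SkewPBW.idealOfPoints ι x (SkewPBW.vanishingSet ι x (I : Set A)) := by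
  subst hJ
  exact mainTheorem1_general ι x hA.closure_eq_top (Subring.center A).subtype
    (Subring.range_subtype _).le κ y hZ.surjective I
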